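/- Let $S,A$ be finite sets of states and actions. When action $a\in A$ is taken in state $s\in S$, a real cost is incurred with law $\theta(\cdot\mid s,a)$, which has finite mean $\mathbb E_\theta[c\mid s,a]$, and the next state has law $p(\cdot\mid s,a)$. Fix a discount factor $0\le\gamma<1$, a parameter $\beta>0$ and a prior policy $\rho(\cdot\mid s)$, a probability distribution on $A$ for each $s\in S$. For $G:S\times A\to\mathbb R$ define $$\mathbf B^*[G](s,a)=\mathbb E_\theta[c\mid s,a]-\frac{\gamma}{\beta}\sum_{s'\in S}p(s'\mid s,a)\,\log\sum_{a'\in A}\rho(a'\mid s')e^{-\beta G(s',a')}.$$ Let $s_0,a_0,c_0,s_1,a_1,c_1,\dots$ be a run of this Markov decision process on a probability space with a filtration $(\mathcal F_t)_{t\ge0}$: $s_t$ and $a_t$ are $\mathcal F_t$-measurable, $c_t$ is $\mathcal F_{t+1}$-measurable, and conditionally on $\mathcal F_t$ the cost $c_t$ has law $\theta(\cdot\mid s_t,a_t)$ and the state $s_{t+1}$ has law $p(\cdot\mid s_t,a_t)$. (The actions may thus be chosen by any non-anticipating exploration policy.) Let $\alpha_t\in[0,1]$ be $\mathcal F_t$-measurable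 learning rates. Starting from an arbitrary fixed $G_0:S\times A\to\mathbb R$, the G-learning iterates are defined by $$G_{t+1}(s_t,a_t)=(1-\alpha_t)G_t(s_t,a_t)+\alpha_t\Big(c_t-\frac{\gamma}{\beta}\log\sum_{a'\in A}\rho(a'\mid s_{t+1})e^{-\beta G_t(s_{t+1},a')}\Big),$$ and $G_{t+1}(s,a)=G_t(s,a)$ for $(s,a)\ne(s_t,a_t)$. The noise at step $t$ is $$z_t=-\mathbf B^*[G_t](s_t,a_t)+c_t-\frac{\gamma}{\beta}\log\sum_{a'\in A}\rho(a'\mid s_{t+1})e^{-\beta G_t(s_{t+1},a')}.$$ Suppose that, with probability 1, - every pair $(s,a)\in S\times A$ is visited infinitely often, that is, $(s_t,a_t)=(s,a)$ for infinitely many $t$; - for every pair $(s,a)\in S\times A$, the learning rates used at the visits to that pair satisfy $\sum_{t:(s_t,a_t)=(s,a)}\alpha_t=\infty$; - $\sum_t\alpha_t^2<\infty$; and that the noise is bounded: there is a constant $K$ such that, with probability 1, $|z_t|\le K$ for all $t$. Then $\mathbf B^*$ has a unique fixed point $G^*$, and with probability 1, $G_t(s,a)\to G^*(s,a)$ as $t\to\infty$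 for every $(s,a)\in S\times A$. -/

import Mathlib

open MeasureTheory ProbabilityTheory Filter Topology

noncomputable section

/-- A finite Markov decision process with states `S`, actions `A`: the transition probabilities
`trans s a s' = p(s' | s, a)` and the distributions `cost s a = θ(· | s, a)` of the real-valued
cost, which have a finite mean. -/
structure GMDP (S A : Type*) [Fintype S] where
  trans : S → A → S → ℝ
  trans_nonneg : ∀ s a s', 0 ≤ trans s a s'
  trans_sum : ∀ s a, ∑ s', trans s a s' = 1
  cost : S → A → Measure ℝ
  cost_prob : ∀ s a, IsProbabilityMeasure (cost s a)
  cost_integrable : ∀ s a, Integrable (fun c : ℝ => c) (cost s a)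

/-- A stochastic policy `ρ(a | s)`, written `ρ s a`. -/
structure IsPolicy {S A : Type*} [Fintype A] (ρ : S → A → ℝ) : Prop where
  nonneg : ∀ s a, 0 ≤ ρ s a
  sum_one : ∀ s, ∑ a, ρ s a = 1

/-- `log ∑_{a'} ρ(a' | s') exp (-β G(s', a'))`. -/
def logPartition {S A : Type*} [Fintype A] (ρ : S → A → ℝ) (β : ℝ) (G : S → A → ℝ) (s' : S) : ℝ :=
  Real.log (∑ a', ρ s' a' * Real.exp (-β * G s' a'))

/-- The operator
`B*[G](s, a) = E_θ[c | s, a] - (γ / β) E_p[log ∑_{a'} ρ(a' | s') exp (-β G(s', a')) | s, a]`. -/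
def bellmanStar {S A : Type*} [Fintype S] [Fintype A] (M : GMDP S A) (γ β : ℝ) (ρ : S → A → ℝ)
    (G : S → A → ℝ) : S → A → ℝ :=
  fun s a => (∫ c, c ∂(M.cost s a)) - γ / β * ∑ s', M.trans s a s' * logPartition ρ β G s'

/-- The sampled target `c - (γ / β) log ∑_{a'} ρ(a' | s') exp (-β G(s', a'))` of an update, when the
cost `c` has been incurred and the next state `s'` observed. -/
def sampleTarget {S A : Type*} [Fintype A] (γ β : ℝ) (ρ : S → A → ℝ) (G : S → A → ℝ)
    (c : ℝ) (s' : S) : ℝ :=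
  c - γ / β * logPartition ρ β G s'

/-- The G-learning iterates along one run with states `s`, actions `a`, costs `c` and learning
rates `α`, started at `G0`: step `t` changes only the entry at `(s t, a t)`. -/
def gLearning {S A : Type*} [Fintype A] [DecidableEq S] [DecidableEq A]
    (γ β : ℝ) (ρ : S → A → ℝ) (G0 : S → A → ℝ)
    (s : ℕ → S) (a : ℕ → A) (c α : ℕ → ℝ) : ℕ → S → A → ℝ
  | 0 => G0
  | t + 1 => fun x u =>
      if x = s t ∧ u = a t then
        (1 - α t) * gLearning γ β ρ G0 s a c α t x u
          + α t * sampleTarget γ β ρ (gLearning γ β ρ G0 s a c α t) (c t) (s (t + 1))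
      else gLearning γ β ρ G0 s a c α t x u

/-- The noise `z_t` of step `t`: the sampled target minus `B*[G_t](s_t, a_t)`. -/
def gNoise {S A : Type*} [Fintype S] [Fintype A] [DecidableEq S] [DecidableEq A]
    (M : GMDP S A) (γ β : ℝ) (ρ : S → A → ℝ) (G0 : S → A → ℝ)
    (s : ℕ → S) (a : ℕ → A) (c α : ℕ → ℝ) (t : ℕ) : ℝ :=
  - bellmanStar M γ β ρ (gLearning γ β ρ G0 s a c α t) (s t) (a t)
    + sampleTarget γ β ρ (gLearning γ β ρ G0 s a c α t) (c t) (s (t + 1))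

/-- `s_0, a_0, c_0, s_1, a_1, c_1, …` is a run of the MDP `M`. The σ-algebra `ℱ t` is the information
available once `s_t` and `a_t` are known and before `c_t` and `s_{t+1}` are drawn; given it, the cost
has law `θ(· | s_t, a_t)` and the next state has law `p(· | s_t, a_t)`. The actions are chosen by an
arbitrary, possibly randomized, non-anticipating exploration policy. -/
structure IsRun {S A Ω : Type*} [Fintype S] [MeasurableSpace S] [MeasurableSpace A]
    {mΩ : MeasurableSpace Ω} (M : GMDP S A) (P : Measure Ω) (ℱ : Filtration ℕ mΩ)
    (s : ℕ → Ω → S) (a : ℕ → Ω → A) (c : ℕ → Ω → ℝ) : Prop where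
  state_meas : ∀ t, Measurable[ℱ t] (s t)
  action_meas : ∀ t, Measurable[ℱ t] (a t)
  cost_meas : ∀ t, Measurable[ℱ (t + 1)] (c t)
  cost_law : ∀ t, ∀ B : Set ℝ, MeasurableSet B →
    P[(c t ⁻¹' B).indicator (fun _ => (1 : ℝ)) | ℱ t]
      =ᵐ[P] fun ω => (M.cost (s t ω) (a t ω)).real B
  state_law : ∀ t, ∀ s' : S,
    P[(s (t + 1) ⁻¹' {s'}).indicator (fun _ => (1 : ℝ)) | ℱ t]
      =ᵐ[P] fun ω => M.trans (s t ω) (a t ω) s'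

end

/-!
In the sup metric, `logPartition` is `β`-Lipschitz, because `∑ ρ exp (-β G)` is an average and is
multiplied by at most `exp (β d)` when `G` changes by at most `d`. Hence `bellmanStar` is a
`γ`-contraction, and Banach's theorem gives its unique fixed point `G*`.

An update at a pair has the form `G ← (1 - b) G + b (B*[G] + z)`, where `b` is the learning rate at
the visits to that pair and `0` otherwise. The convergence combines two facts.

* *Along almost every run the series `∑ b_t z_t` converges* for every pair. Since `|z_t| ≤ K`, the
  iterates stay in a fixed ball (`exists_bound_gLearning`), so everything is integrable and the
  noise has conditional mean zero (`IsRun.condExp_gNoise`). The sum of squares `∑ b_t²` is finite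
  only almost surely, with no bound on its expectation; once the weights are cut off when it exceeds
  a level `L`, the partial sums form a martingale bounded in `L²`, which converges, and on the event
  `∑ b_t² ≤ L` the cut-off changes nothing (`ae_tendsto_sum_mul_of_summable_sq`).
* *A deterministic argument along a single run* (`tendsto_zero_of_asynchronous_contraction`). With
  `y = G - G*` and `R` the tail of the convergent series `∑ b_t z_t`, the sum `y + R` satisfies the
  recursion with the noise `z` replaced by the vanishing sequence `R`. If `|y| ≤ D` eventually, then
  the contraction and `∑ b_t = ∞` give `|y| ≤ γ D + ε` eventually, so the best eventual bound is
  zero.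
-/

/-! ### Asynchronous relaxation along a single sequence -/

/-- Relaxing towards targets of size at most `b` brings a sequence within any `ε` of the
interval `[-b, b]`: each step shrinks the excess of `|y|` over `b` by the factor
`1 - a t ≤ exp (-a t)`, and the steps sum to infinity. -/
theorem eventually_le_add_of_relaxation {y e a : ℕ → ℝ}
    (hy : ∀ t, y (t + 1) = (1 - a t) * y t + a t * e t)
    (ha : ∀ t, 0 ≤ a t ∧ a t ≤ 1)
    (hsum : Tendsto (fun n => ∑ t ∈ Finset.range n, a t) atTop atTop)
    {b : ℝ} (he : ∀ᶠ t in atTop, |e t| ≤ b) {ε : ℝ} (hε : 0 < ε) :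
    ∀ᶠ t in atTop, |y t| ≤ b + ε := by
  obtain ⟨T, hT⟩ := eventually_atTop.1 he
  set u : ℕ → ℝ := fun t => max (|y t| - b) 0 with hu
  have hu0 : ∀ t, 0 ≤ u t := fun t => le_max_right _ _
  have hstep : ∀ t, T ≤ t → u (t + 1) ≤ Real.exp (-a t) * u t := by
    intro t ht
    have h1 : (1 - a t) * u t ≤ Real.exp (-a t) * u t :=
      mul_le_mul_of_nonneg_right (by linarith [Real.add_one_le_exp (-a t)]) (hu0 t)
    have h3 : 0 ≤ 1 - a t := by linarith [(ha t).2]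
    refine le_trans (max_le ?_ (mul_nonneg h3 (hu0 t))) h1
    have h2 : |y (t + 1)| ≤ (1 - a t) * |y t| + a t * b := by
      rw [hy t]
      refine (abs_add_le _ _).trans ?_
      rw [abs_mul, abs_mul, abs_of_nonneg h3, abs_of_nonneg (ha t).1]
      gcongr
      · exact (ha t).1
      · exact hT t ht
    have h4 : (1 - a t) * (|y t| - b) ≤ (1 - a t) * u t :=
      mul_le_mul_of_nonneg_left (le_max_left _ _) h3
    linarith
  have hexp : ∀ t, T ≤ t → u t ≤
      Real.exp (∑ k ∈ Finset.range T, a k - ∑ k ∈ Finset.range t, a k) * u T := by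
    intro t ht
    induction t, ht using Nat.le_induction with
    | base => simp
    | succ t ht ih =>
      refine (hstep t ht).trans ((mul_le_mul_of_nonneg_left ih (Real.exp_pos _).le).trans_eq ?_)
      rw [← mul_assoc, ← Real.exp_add, Finset.sum_range_succ]
      ring_nf
  have hlim : Tendsto (fun t => Real.exp (∑ k ∈ Finset.range T, a k - ∑ k ∈ Finset.range t, a k)
      * u T) atTop (𝓝 0) := by
    have := (Real.tendsto_exp_atBot.comp
      (tendsto_atBot_add_const_left atTop (∑ k ∈ Finset.range T, a k)
        (tendsto_neg_atTop_atBot.comp hsum))).mul_const (u T)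
    simpa [Function.comp_def, sub_eq_add_neg] using this
  filter_upwards [hlim.eventually (gt_mem_nhds hε), eventually_ge_atTop T] with t h1 h2
  have h3 := hexp t h2
  have h4 : |y t| - b ≤ u t := le_max_left _ _
  linarith

/-- Each coordinate `i` relaxes with its own step sizes `a · i` towards a target `f · i`, which is
smaller than the current sup bound by the factor `γ`, plus a noise whose weighted series
converges. -/
theorem tendsto_zero_of_asynchronous_contraction {ι : Type*} [Finite ι] {γ : ℝ}
    (hγ0 : 0 ≤ γ) (hγ1 : γ < 1) {y f z a : ℕ → ι → ℝ}
    (hy : ∀ t i, y (t + 1) i = (1 - a t i) * y t i + a t i * (f t i + z t i))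
    (ha : ∀ t i, 0 ≤ a t i ∧ a t i ≤ 1)
    (hsum : ∀ i, Tendsto (fun n => ∑ t ∈ Finset.range n, a t i) atTop atTop)
    (hf : ∀ t d, (∀ j, |y t j| ≤ d) → ∀ i, |f t i| ≤ γ * d)
    (hz : ∀ i, ∃ l, Tendsto (fun n => ∑ t ∈ Finset.range n, a t i * z t i) atTop (𝓝 l))
    (hbdd : ∃ D, ∀ t i, |y t i| ≤ D) (i : ι) :
    Tendsto (fun t => y t i) atTop (𝓝 0) := by
  choose l hl using hz
  set R : ℕ → ι → ℝ := fun t i => l i - ∑ k ∈ Finset.range t, a k i * z k i with hR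
  have hRlim : ∀ i, Tendsto (fun t => R t i) atTop (𝓝 0) := fun i => by
    simpa [hR] using (hl i).const_sub (l i)
  have hRsmall : ∀ ε > 0, ∀ᶠ t in atTop, ∀ i, |R t i| ≤ ε := fun ε hε =>
    eventually_all.2 fun i => by
      have h := (hRlim i).abs
      rw [abs_zero] at h
      exact (h.eventually (gt_mem_nhds hε)).mono fun t ht => ht.le
  -- Adding the tail of the noise series turns the noise into a vanishing perturbation.
  have hrec : ∀ t i, y (t + 1) i + R (t + 1) i
      = (1 - a t i) * (y t i + R t i) + a t i * (f t i + R t i) := by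
    intro t i
    simp only [hR, hy t i, Finset.sum_range_succ]
    ring
  have himprove : ∀ D, (∀ᶠ t in atTop, ∀ i, |y t i| ≤ D) → ∀ ε > 0,
      ∀ᶠ t in atTop, ∀ i, |y t i| ≤ γ * D + ε := by
    intro D hD ε hε
    have h1 : ∀ᶠ t in atTop, ∀ i, |y t i + R t i| ≤ γ * D + ε / 3 + ε / 3 := by
      refine eventually_all.2 fun i => eventually_le_add_of_relaxation
        (y := fun t => y t i + R t i) (fun t => hrec t i) (fun t => ha t i) (hsum i) ?_ (by linarith)
      filter_upwards [hD, hRsmall (ε / 3) (by linarith)] with t h2 h3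
      exact (abs_add_le _ _).trans (add_le_add (hf t D h2 i) (h3 i))
    filter_upwards [h1, hRsmall (ε / 3) (by linarith)] with t h2 h3 i
    have h4 := abs_sub (y t i + R t i) (R t i)
    rw [add_sub_cancel_right] at h4
    linarith [h2 i, h3 i]
  obtain ⟨D₀, hD₀⟩ := hbdd
  -- The infimum of the eventual bounds is at most `γ` times itself, hence zero.
  set E : Set ℝ := {D | ∀ᶠ t in atTop, ∀ i, |y t i| ≤ D} with hE
  have hEne : E.Nonempty := ⟨D₀, Eventually.of_forall fun t => hD₀ t⟩
  have hE0 : ∀ D ∈ E, 0 ≤ D := fun D hD => by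
    obtain ⟨t, ht⟩ := hD.exists
    exact (abs_nonneg _).trans (ht i)
  have hEb : BddBelow E := ⟨0, hE0⟩
  have hd : sInf E ≤ γ * sInf E := by
    refine le_of_forall_pos_le_add fun ε hε => ?_
    obtain ⟨D, hDE, hD⟩ := exists_lt_of_csInf_lt hEne (lt_add_of_pos_right (sInf E) (half_pos hε))
    have h1 := csInf_le hEb (himprove D hDE (ε / 2) (half_pos hε))
    have h2 : γ * D ≤ γ * (sInf E + ε / 2) := mul_le_mul_of_nonneg_left hD.le hγ0
    nlinarith
  have hd0 : sInf E ≤ 0 := by nlinarith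
  refine Metric.tendsto_nhds.2 fun ε hε => ?_
  obtain ⟨D, hDE, hD⟩ := exists_lt_of_csInf_lt hEne (lt_of_le_of_lt hd0 hε)
  filter_upwards [hDE] with t ht
  rw [Real.dist_eq, sub_zero]
  exact (ht i).trans_lt hD

/-! ### The soft Bellman operator and the iterates -/

section Bellman

variable {S A : Type*} [Fintype A] {ρ : S → A → ℝ} {β γ : ℝ}

theorem partition_pos (hρ : IsPolicy ρ) (β : ℝ) (G : S → A → ℝ) (x : S) :
    0 < ∑ u, ρ x u * Real.exp (-β * G x u) := by
  have hnn : ∀ u ∈ Finset.univ, 0 ≤ ρ x u * Real.exp (-β * G x u) := fun u _ =>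
    mul_nonneg (hρ.nonneg x u) (Real.exp_pos _).le
  refine (Finset.sum_nonneg hnn).lt_of_ne' fun h => ?_
  have h0 := (Finset.sum_eq_zero_iff_of_nonneg hnn).1 h
  have h1 : ∑ u, ρ x u = 0 := Finset.sum_eq_zero fun u hu =>
    (mul_eq_zero.1 (h0 u hu)).resolve_right (Real.exp_pos _).ne'
  linarith [hρ.sum_one x]

theorem logPartition_le_add (hρ : IsPolicy ρ) (hβ : 0 < β) {G H : S → A → ℝ} {d : ℝ} {x : S}
    (h : ∀ u, H x u ≤ G x u + d) : logPartition ρ β G x ≤ logPartition ρ β H x + β * d := by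
  have hZ := partition_pos hρ β H x
  rw [logPartition, logPartition, ← Real.log_exp (β * d),
    ← Real.log_mul hZ.ne' (Real.exp_pos _).ne']
  refine Real.log_le_log (partition_pos hρ β G x) ?_
  rw [Finset.sum_mul]
  refine Finset.sum_le_sum fun u _ => ?_
  rw [mul_assoc, ← Real.exp_add]
  refine mul_le_mul_of_nonneg_left (Real.exp_le_exp.2 ?_) (hρ.nonneg x u)
  nlinarith [h u]

theorem abs_logPartition_sub_le (hρ : IsPolicy ρ) (hβ : 0 < β) {G H : S → A → ℝ} {d : ℝ} {x : S}
    (h : ∀ u, |G x u - H x u| ≤ d) : |logPartition ρ β G x - logPartition ρ β H x| ≤ β * d := by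
  have h1 : logPartition ρ β G x ≤ logPartition ρ β H x + β * d :=
    logPartition_le_add hρ hβ fun u => by linarith [(abs_le.1 (h u)).1]
  have h2 : logPartition ρ β H x ≤ logPartition ρ β G x + β * d :=
    logPartition_le_add hρ hβ fun u => by linarith [(abs_le.1 (h u)).2]
  exact abs_le.2 ⟨by linarith, by linarith⟩

theorem abs_logPartition_le (hρ : IsPolicy ρ) (hβ : 0 < β) {G : S → A → ℝ} {d : ℝ} {x : S}
    (h : ∀ u, |G x u| ≤ d) : |logPartition ρ β G x| ≤ β * d := by
  have h0 : logPartition ρ β (fun _ _ => 0) x = 0 := by simp [logPartition, hρ.sum_one]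
  have h1 := abs_logPartition_sub_le (G := G) (H := fun _ _ => 0) hρ hβ (by simpa using h)
  rwa [h0, sub_zero] at h1

variable [Fintype S]

theorem abs_bellmanStar_sub_le (M : GMDP S A) (hγ0 : 0 ≤ γ) (hρ : IsPolicy ρ) (hβ : 0 < β)
    {G H : S → A → ℝ} {d : ℝ} (h : ∀ x u, |G x u - H x u| ≤ d) (x : S) (u : A) :
    |bellmanStar M γ β ρ G x u - bellmanStar M γ β ρ H x u| ≤ γ * d := by
  have h1 : |∑ x', M.trans x u x' * (logPartition ρ β G x' - logPartition ρ β H x')| ≤ β * d := by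
    refine (Finset.abs_sum_le_sum_abs _ _).trans ?_
    calc ∑ x', |M.trans x u x' * (logPartition ρ β G x' - logPartition ρ β H x')|
        ≤ ∑ x', M.trans x u x' * (β * d) := Finset.sum_le_sum fun x' _ => by
          rw [abs_mul, abs_of_nonneg (M.trans_nonneg x u x')]
          exact mul_le_mul_of_nonneg_left (abs_logPartition_sub_le hρ hβ (h x'))
            (M.trans_nonneg x u x')
      _ = β * d := by rw [← Finset.sum_mul, M.trans_sum, one_mul]
  have h2 : bellmanStar M γ β ρ G x u - bellmanStar M γ β ρ H x u
      = -(γ / β * ∑ x', M.trans x u x' * (logPartition ρ β G x' - logPartition ρ β H x')) := by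
    simp only [bellmanStar, mul_sub, Finset.sum_sub_distrib]
    ring
  rw [h2, abs_neg, abs_mul, abs_of_nonneg (div_nonneg hγ0 hβ.le)]
  calc _ ≤ γ / β * (β * d) := mul_le_mul_of_nonneg_left h1 (div_nonneg hγ0 hβ.le)
    _ = γ * d := by field_simp

theorem existsUnique_bellmanStar_fixedPoint (M : GMDP S A) (hγ0 : 0 ≤ γ) (hγ1 : γ < 1)
    (hρ : IsPolicy ρ) (hβ : 0 < β) :
    ∃ G, bellmanStar M γ β ρ G = G ∧ ∀ H, bellmanStar M γ β ρ H = H → H = G := by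
  have hc : ContractingWith ⟨γ, hγ0⟩ (bellmanStar M γ β ρ) := by
    refine ⟨by exact_mod_cast hγ1, LipschitzWith.of_dist_le_mul fun G H => ?_⟩
    have hnn : 0 ≤ γ * dist G H := mul_nonneg hγ0 dist_nonneg
    refine (dist_pi_le_iff hnn).2 fun x => (dist_pi_le_iff hnn).2 fun u => ?_
    exact abs_bellmanStar_sub_le M hγ0 hρ hβ
      (fun x u => (dist_le_pi_dist (G x) (H x) u).trans (dist_le_pi_dist G H x)) x u
  exact ⟨hc.fixedPoint, hc.fixedPoint_isFixedPt, fun H hH => hc.fixedPoint_unique hH⟩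

variable [DecidableEq S] [DecidableEq A]

/-- All entries obey one recursion, with learning rate zero at the pairs that are not visited. -/
theorem gLearning_succ (M : GMDP S A) (γ β : ℝ) (ρ G0 : S → A → ℝ) (s : ℕ → S) (a : ℕ → A)
    (c α : ℕ → ℝ) (t : ℕ) (x : S) (u : A) :
    gLearning γ β ρ G0 s a c α (t + 1) x u
      = (1 - if s t = x ∧ a t = u then α t else 0) * gLearning γ β ρ G0 s a c α t x u
        + (if s t = x ∧ a t = u then α t else 0)
          * (bellmanStar M γ β ρ (gLearning γ β ρ G0 s a c α t) x u
            + gNoise M γ β ρ G0 s a c α t) := by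
  rw [gLearning]
  by_cases h : s t = x ∧ a t = u
  · obtain ⟨rfl, rfl⟩ := h
    simp [gNoise]
  · have h' : ¬ (x = s t ∧ u = a t) := fun h' => h ⟨h'.1.symm, h'.2.symm⟩
    simp [h, h']

/-- Bounded noise confines the iterates to a ball that depends neither on the run nor on the learning
rates. -/
theorem exists_bound_gLearning (M : GMDP S A) (hγ0 : 0 ≤ γ) (hγ1 : γ < 1)
    (hρ : IsPolicy ρ) (hβ : 0 < β) (G0 : S → A → ℝ) (K : ℝ) :
    ∃ m : ℝ, ∀ (s : ℕ → S) (a : ℕ → A) (c α : ℕ → ℝ), (∀ t, 0 ≤ α t ∧ α t ≤ 1) →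
      (∀ t, |gNoise M γ β ρ G0 s a c α t| ≤ K) →
      ∀ t x u, |gLearning γ β ρ G0 s a c α t x u| ≤ m := by
  set B0 := bellmanStar M γ β ρ 0
  have hle : ∀ (F : S → A → ℝ) x u, |F x u| ≤ ‖F‖ := fun F x u =>
    (norm_le_pi_norm (F x) u).trans (norm_le_pi_norm F x)
  -- The ball of radius `m` is invariant because `‖B*[0]‖ + γ m + K ≤ m`.
  set m := max ‖G0‖ ((‖B0‖ + K) / (1 - γ))
  have hm : ‖B0‖ + K ≤ m * (1 - γ) :=
    (div_le_iff₀ (by linarith)).1 (le_max_right _ _)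
  refine ⟨m, fun s a c α hα hz t => ?_⟩
  induction t with
  | zero => exact fun x u => (hle G0 x u).trans (le_max_left _ _)
  | succ t ih =>
    intro x u
    rw [gLearning_succ M]
    set b := if s t = x ∧ a t = u then α t else 0
    have hb : 0 ≤ b ∧ b ≤ 1 := by
      simp only [b]; split_ifs
      · exact hα t
      · exact ⟨le_rfl, zero_le_one⟩
    set G := gLearning γ β ρ G0 s a c α t
    have h1 := abs_bellmanStar_sub_le M hγ0 hρ hβ (G := G) (H := 0) (by simpa using ih) x u
    have h2 : |bellmanStar M γ β ρ G x u + gNoise M γ β ρ G0 s a c α t| ≤ m := by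
      have h3 := hle B0 x u
      have h4 := hz t
      rw [abs_le] at *
      constructor <;> linarith
    refine (abs_add_le _ _).trans ?_
    rw [abs_mul, abs_mul, abs_of_nonneg hb.1, abs_of_nonneg (by linarith : 0 ≤ 1 - b)]
    nlinarith [ih x u, mul_le_mul_of_nonneg_left (ih x u) (by linarith : 0 ≤ 1 - b),
      mul_le_mul_of_nonneg_left h2 hb.1]

/-- Convergence along a single run on which, at every pair, the noise weighted by the learning rates
is a convergent series. -/
theorem tendsto_gLearning_of_noise_summable (M : GMDP S A) (hγ0 : 0 ≤ γ) (hγ1 : γ < 1)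
    (hρ : IsPolicy ρ) (hβ : 0 < β) {Gstar : S → A → ℝ} (hG : bellmanStar M γ β ρ Gstar = Gstar)
    {G0 : S → A → ℝ} {s : ℕ → S} {a : ℕ → A} {c α : ℕ → ℝ} (hα : ∀ t, 0 ≤ α t ∧ α t ≤ 1)
    (hsum : ∀ x u, Tendsto
      (fun n => ∑ t ∈ Finset.range n, if s t = x ∧ a t = u then α t else 0) atTop atTop)
    {K : ℝ} (hK : ∀ t, |gNoise M γ β ρ G0 s a c α t| ≤ K)
    (hz : ∀ x u, ∃ l, Tendsto (fun n => ∑ t ∈ Finset.range n,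
      (if s t = x ∧ a t = u then α t else 0) * gNoise M γ β ρ G0 s a c α t) atTop (𝓝 l))
    (x : S) (u : A) :
    Tendsto (fun t => gLearning γ β ρ G0 s a c α t x u) atTop (𝓝 (Gstar x u)) := by
  obtain ⟨m, hm⟩ := exists_bound_gLearning M hγ0 hγ1 hρ hβ G0 K
  rw [← tendsto_sub_nhds_zero_iff]
  refine tendsto_zero_of_asynchronous_contraction hγ0 hγ1
    (y := fun t (i : S × A) => gLearning γ β ρ G0 s a c α t i.1 i.2 - Gstar i.1 i.2)
    (f := fun t i => bellmanStar M γ β ρ (gLearning γ β ρ G0 s a c α t) i.1 i.2 - Gstar i.1 i.2)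
    (z := fun t _ => gNoise M γ β ρ G0 s a c α t)
    (a := fun t i => if s t = i.1 ∧ a t = i.2 then α t else 0)
    (fun t i => ?_) (fun t i => ?_) (fun i => hsum i.1 i.2) (fun t d hd i => ?_)
    (fun i => hz i.1 i.2) ⟨m + ‖Gstar‖, fun t i => ?_⟩ (x, u)
  · rw [gLearning_succ M]; ring
  · split_ifs
    · exact hα t
    · exact ⟨le_rfl, zero_le_one⟩
  · have := abs_bellmanStar_sub_le M hγ0 hρ hβ (fun x u => hd (x, u)) i.1 i.2
    rwa [hG] at this
  · exact (abs_sub _ _).trans (add_le_add (hm s a c α hα hK t i.1 i.2)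
      ((norm_le_pi_norm (Gstar i.1) i.2).trans (norm_le_pi_norm Gstar i.1)))

end Bellman

/-! ### Martingale transforms and conditional laws -/

section Probability

variable {Ω : Type*} {m mΩ : MeasurableSpace Ω} {P : Measure Ω}

theorem condExp_mul_eq_zero (hm : m ≤ mΩ) {g z : Ω → ℝ}
    (hg : Measurable[m] g) (hz : Integrable z P) (hzm : P[z | m] =ᵐ[P] 0)
    {C : ℝ} (hgC : ∀ᵐ ω ∂P, |g ω| ≤ C) :
    Integrable (fun ω => g ω * z ω) P ∧ P[fun ω => g ω * z ω | m] =ᵐ[P] 0 := by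
  have hint : Integrable (fun ω => g ω * z ω) P :=
    hz.bdd_mul (hg.mono hm le_rfl).aestronglyMeasurable hgC
  refine ⟨hint, ?_⟩
  filter_upwards [condExp_mul_of_stronglyMeasurable_left hg.stronglyMeasurable hint hz, hzm]
    with ω h1 h2
  exact h1.trans (by simp [h2])

theorem integral_mul_eq_zero [IsProbabilityMeasure P] (hm : m ≤ mΩ) {g z : Ω → ℝ}
    (hg : Measurable[m] g) (hz : Integrable z P) (hzm : P[z | m] =ᵐ[P] 0)
    {C : ℝ} (hgC : ∀ᵐ ω ∂P, |g ω| ≤ C) : ∫ ω, g ω * z ω ∂P = 0 := by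
  rw [← integral_condExp hm, integral_congr_ae (condExp_mul_eq_zero hm hg hz hzm hgC).2]
  simp

variable [IsProbabilityMeasure P] {ℱ : Filtration ℕ mΩ} {z b : ℕ → Ω → ℝ} {K L : ℝ}

/-- A martingale transform of bounded martingale differences converges almost surely when the squared
weights have a uniformly bounded sum. -/
theorem ae_tendsto_sum_mul_of_sum_sq_le
    (hzm : ∀ t, Measurable[ℱ (t + 1)] (z t)) (hK : 0 ≤ K) (hzK : ∀ᵐ ω ∂P, ∀ t, |z t ω| ≤ K)
    (hz0 : ∀ t, P[z t | ℱ t] =ᵐ[P] 0) (hbm : ∀ t, Measurable[ℱ t] (b t))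
    (hb : ∀ n ω, ∑ t ∈ Finset.range n, b t ω ^ 2 ≤ L) :
    ∀ᵐ ω ∂P, ∃ l, Tendsto (fun n => ∑ t ∈ Finset.range n, b t ω * z t ω) atTop (𝓝 l) := by
  have hzint : ∀ t, Integrable (z t) P := fun t =>
    Integrable.of_bound ((hzm t).mono (ℱ.le _) le_rfl).aestronglyMeasurable K
      (hzK.mono fun ω h => h t)
  have hb1 : ∀ t ω, |b t ω| ≤ L + 1 := fun t ω => by
    have h1 : b t ω ^ 2 ≤ L := (Finset.single_le_sum (f := fun t => b t ω ^ 2)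
      (fun i _ => sq_nonneg _) (Finset.self_mem_range_succ t)).trans (hb (t + 1) ω)
    -- `|x| ≤ x² + 1`
    nlinarith [sq_abs (b t ω), sq_nonneg (|b t ω| - 1), abs_nonneg (b t ω)]
  set N : ℕ → Ω → ℝ := fun n ω => ∑ t ∈ Finset.range n, b t ω * z t ω with hN
  have hNm : ∀ n, Measurable[ℱ n] (N n) := fun n =>
    Finset.measurable_sum _ fun t ht =>
      (((hbm t).mono (ℱ.mono (Finset.mem_range.1 ht).le) le_rfl).mul
        ((hzm t).mono (ℱ.mono (Finset.mem_range.1 ht)) le_rfl))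
  have hNb : ∀ n, ∀ᵐ ω ∂P, |N n ω| ≤ n * ((L + 1) * K) := fun n => by
    filter_upwards [hzK] with ω hω
    refine (Finset.abs_sum_le_sum_abs _ _).trans ?_
    refine (Finset.sum_le_card_nsmul _ _ ((L + 1) * K) fun t _ => ?_).trans_eq (by simp)
    rw [abs_mul]
    exact mul_le_mul (hb1 t ω) (hω t) (abs_nonneg _) ((abs_nonneg _).trans (hb1 t ω))
  have hNm' : ∀ n, Measurable (N n) := fun n => (hNm n).mono (ℱ.le n) le_rfl
  have hbm' : ∀ n, Measurable (b n) := fun n => (hbm n).mono (ℱ.le n) le_rfl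
  have hNint : ∀ n, Integrable (N n) P := fun n =>
    Integrable.of_bound (hNm' n).aestronglyMeasurable _ (hNb n)
  have hNsq : ∀ n, Integrable (fun ω => N n ω ^ 2) P := fun n => by
    simp_rw [pow_two]
    exact (hNint n).bdd_mul (hNm' n).aestronglyMeasurable (hNb n)
  have hbsq : ∀ n, Integrable (fun ω => b n ω ^ 2) P := fun n =>
    Integrable.of_bound ((hbm' n).pow_const 2).aestronglyMeasurable ((L + 1) ^ 2)
      (Eventually.of_forall fun ω => by
        rw [Real.norm_eq_abs, abs_pow]
        exact pow_le_pow_left₀ (abs_nonneg _) (hb1 n ω) 2)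
  have hmart : Martingale N ℱ P := by
    refine martingale_of_condExp_sub_eq_zero_nat (fun n => (hNm n).stronglyMeasurable) hNint
      fun t => ?_
    have h1 : N (t + 1) - N t = fun ω => b t ω * z t ω := by
      ext ω; simp [hN, Finset.sum_range_succ]
    rw [h1]
    exact (condExp_mul_eq_zero (ℱ.le t) (hbm t) (hzint t) (hz0 t)
      (Eventually.of_forall (hb1 t))).2
  -- Increments of the martingale are orthogonal, so its second moments add up.
  have hsecond : ∀ n, ∫ ω, N n ω ^ 2 ∂P
      ≤ K ^ 2 * ∑ t ∈ Finset.range n, ∫ ω, b t ω ^ 2 ∂P := by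
    intro n
    induction n with
    | zero => simp [hN]
    | succ n ih =>
      have hgb : ∀ᵐ ω ∂P, |2 * N n ω * b n ω| ≤ 2 * (n * ((L + 1) * K)) * (L + 1) := by
        filter_upwards [hNb n] with ω h
        rw [abs_mul, abs_mul, abs_two]
        exact mul_le_mul (by linarith) (hb1 n ω) (abs_nonneg _)
          (by linarith [abs_nonneg (N n ω)])
      have hgm : Measurable[ℱ n] fun ω => 2 * N n ω * b n ω :=
        ((hNm n).const_mul 2).mul (hbm n)
      have hcross := integral_mul_eq_zero (ℱ.le n) hgm (hzint n) (hz0 n) hgb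
      have hcint := (condExp_mul_eq_zero (ℱ.le n) hgm (hzint n) (hz0 n) hgb).1
      calc ∫ ω, N (n + 1) ω ^ 2 ∂P
          ≤ ∫ ω, (N n ω ^ 2 + 2 * N n ω * b n ω * z n ω) + K ^ 2 * b n ω ^ 2 ∂P := by
            refine integral_mono_ae (hNsq (n + 1))
              (((hNsq n).add hcint).add ((hbsq n).const_mul _)) ?_
            filter_upwards [hzK] with ω hω
            have h1 : z n ω ^ 2 ≤ K ^ 2 := sq_le_sq.2 (by rw [abs_of_nonneg hK]; exact hω n)
            have h2 : N (n + 1) ω = N n ω + b n ω * z n ω := by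
              simp [hN, Finset.sum_range_succ]
            simp only [h2]
            nlinarith [mul_le_mul_of_nonneg_right h1 (sq_nonneg (b n ω))]
        _ = ∫ ω, N n ω ^ 2 ∂P + K ^ 2 * ∫ ω, b n ω ^ 2 ∂P := by
            rw [integral_add (f := fun ω => N n ω ^ 2 + 2 * N n ω * b n ω * z n ω)
                ((hNsq n).add hcint) ((hbsq n).const_mul _), integral_add (hNsq n) hcint,
              hcross, integral_const_mul, add_zero]
        _ ≤ _ := by rw [Finset.sum_range_succ]; linarith
  have hsecond' : ∀ n, ∫ ω, N n ω ^ 2 ∂P ≤ K ^ 2 * L := fun n => by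
    refine (hsecond n).trans (mul_le_mul_of_nonneg_left ?_ (sq_nonneg K))
    rw [← integral_finsetSum _ fun t _ => hbsq t]
    refine (integral_mono (integrable_finsetSum _ fun t _ => hbsq t) (integrable_const L)
      (hb n)).trans_eq (by simp)
  have hL1 : ∀ n, eLpNorm (N n) 1 P ≤ ((1 + K ^ 2 * L).toNNReal : ENNReal) := fun n => by
    rw [eLpNorm_one_eq_lintegral_enorm, ← ofReal_integral_norm_eq_lintegral_enorm (hNint n)]
    refine ENNReal.ofReal_le_ofReal ?_
    have h1 : ∫ ω, ‖N n ω‖ ∂P ≤ ∫ ω, 1 + N n ω ^ 2 ∂P :=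
      integral_mono (hNint n).norm ((integrable_const 1).add (hNsq n)) fun ω => by
        simp only [Real.norm_eq_abs]
        nlinarith [sq_abs (N n ω), sq_nonneg (|N n ω| - 1), abs_nonneg (N n ω)]
    rw [integral_add (integrable_const 1) (hNsq n)] at h1
    simp only [integral_const, probReal_univ, smul_eq_mul, mul_one] at h1
    linarith [hsecond' n]
  filter_upwards [hmart.submartingale.ae_tendsto_limitProcess hL1] with ω hω
  exact ⟨_, hω⟩

/-- Localized form: it suffices that the squared weights are almost surely summable. -/
theorem ae_tendsto_sum_mul_of_summable_sq
    (hzm : ∀ t, Measurable[ℱ (t + 1)] (z t)) (hK : 0 ≤ K) (hzK : ∀ᵐ ω ∂P, ∀ t, |z t ω| ≤ K)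
    (hz0 : ∀ t, P[z t | ℱ t] =ᵐ[P] 0) (hbm : ∀ t, Measurable[ℱ t] (b t))
    (hb : ∀ᵐ ω ∂P, Summable fun t => b t ω ^ 2) :
    ∀ᵐ ω ∂P, ∃ l, Tendsto (fun n => ∑ t ∈ Finset.range n, b t ω * z t ω) atTop (𝓝 l) := by
  -- The weights are switched off once the sum of their squares has exceeded `L`.
  set B : ℕ → ℕ → Ω → ℝ := fun L t ω =>
    if ∑ k ∈ Finset.range (t + 1), b k ω ^ 2 ≤ L then b t ω else 0 with hB
  have hBm : ∀ L t, Measurable[ℱ t] (B L t) := fun L t => by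
    have h1 : Measurable[ℱ t] fun ω => ∑ k ∈ Finset.range (t + 1), b k ω ^ 2 :=
      Finset.measurable_sum _ fun k hk =>
        ((hbm k).mono (ℱ.mono (Nat.lt_succ_iff.1 (Finset.mem_range.1 hk))) le_rfl).pow_const 2
    exact Measurable.ite (measurableSet_le h1 measurable_const) (hbm t) measurable_const
  have hBL : ∀ (L : ℕ) n ω, ∑ t ∈ Finset.range n, B L t ω ^ 2 ≤ L := by
    intro L n ω
    induction n with
    | zero => simp
    | succ n ih =>
      by_cases h : ∑ k ∈ Finset.range (n + 1), b k ω ^ 2 ≤ L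
      · refine (Finset.sum_le_sum fun t _ => ?_).trans h
        simp only [hB]
        split_ifs
        · exact le_rfl
        · simpa using sq_nonneg (b t ω)
      · rw [Finset.sum_range_succ]
        simpa [hB, h] using ih
  have hconv := ae_all_iff.2 fun L : ℕ =>
    ae_tendsto_sum_mul_of_sum_sq_le hzm hK hzK hz0 (hBm L) (hBL L)
  filter_upwards [hconv, hb] with ω h1 h2
  obtain ⟨L, hL⟩ := exists_nat_ge (∑' t, b t ω ^ 2)
  obtain ⟨l, hl⟩ := h1 L
  refine ⟨l, hl.congr fun n => Finset.sum_congr rfl fun t _ => ?_⟩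
  have h3 : ∑ k ∈ Finset.range (t + 1), b k ω ^ 2 ≤ L :=
    (h2.sum_le_tsum _ fun k _ => sq_nonneg _).trans hL
  simp [hB, h3]

/-- A variable whose conditional law given `m` is `ν (Y ω)`, with `Y` an `m`-measurable index of
finite range, is integrable, with conditional mean that of `ν (Y ω)`. Indeed, on each event
`E ∩ {Y = i}` with `E` in `m`, its law is a multiple of `ν i`. -/
theorem condExp_eq_integral_of_conditional_law {ι : Type*} [Finite ι]
    (hm : m ≤ mΩ) {Y : Ω → ι} (hY : ∀ i, MeasurableSet[m] (Y ⁻¹' {i})) {f : Ω → ℝ}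
    (hf : Measurable f) {ν : ι → Measure ℝ} (hν : ∀ i, IsProbabilityMeasure (ν i))
    (hνint : ∀ i, Integrable (fun x : ℝ => x) (ν i))
    (hlaw : ∀ B, MeasurableSet B →
      P[(f ⁻¹' B).indicator (fun _ => (1 : ℝ)) | m] =ᵐ[P] fun ω => (ν (Y ω)).real B) :
    Integrable f P ∧ P[f | m] =ᵐ[P] fun ω => ∫ x, x ∂ν (Y ω) := by
  have hmap : ∀ E, MeasurableSet[m] E → ∀ i,
      (P.restrict (E ∩ Y ⁻¹' {i})).map f = P (E ∩ Y ⁻¹' {i}) • ν i := by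
    intro E hE i
    have hE' : MeasurableSet[m] (E ∩ Y ⁻¹' {i}) := hE.inter (hY i)
    ext B hB
    have h1 : ∫ ω in E ∩ Y ⁻¹' {i}, (f ⁻¹' B).indicator (fun _ => (1 : ℝ)) ω ∂P
        = ∫ ω in E ∩ Y ⁻¹' {i}, (ν i).real B ∂P := by
      rw [← setIntegral_condExp hm ((integrable_const 1).indicator (hf hB)) hE']
      refine setIntegral_congr_ae (hm _ hE') ?_
      filter_upwards [hlaw B hB] with ω h2 h3
      rw [h2, show Y ω = i from h3.2]
    rw [integral_indicator_const _ (hf hB), setIntegral_const, smul_eq_mul, mul_one,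
      smul_eq_mul] at h1
    rw [Measure.map_apply hf hB, Measure.smul_apply, smul_eq_mul,
      ← ENNReal.toReal_eq_toReal_iff' (measure_ne_top _ _)
        (ENNReal.mul_ne_top (measure_ne_top _ _) (measure_ne_top _ _)), ENNReal.toReal_mul]
    exact h1
  have hon : ∀ E, MeasurableSet[m] E → ∀ i, IntegrableOn f (E ∩ Y ⁻¹' {i}) P := by
    intro E hE i
    have h1 : Integrable (fun x : ℝ => x) ((P.restrict (E ∩ Y ⁻¹' {i})).map f) := by
      rw [hmap E hE i]
      exact (hνint i).smul_measure (measure_ne_top _ _)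
    exact (integrable_map_measure measurable_id.aestronglyMeasurable hf.aemeasurable).1 h1
  have hcover : ∀ E : Set Ω, E = ⋃ i, E ∩ Y ⁻¹' {i} := fun E => by ext ω; simp
  have hint : Integrable f P := by
    rw [← integrableOn_univ, hcover Set.univ]
    exact integrableOn_finite_iUnion.2 fun i => hon _ MeasurableSet.univ i
  have hgm : Measurable[m] fun ω => ∫ x, x ∂ν (Y ω) := by
    let _ : MeasurableSpace ι := ⊤
    have : Measurable[m] Y := @measurable_to_countable' _ _ ⊤ _ m _ hY
    exact (measurable_of_finite (fun i => ∫ x, x ∂ν i)).comp this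
  have hgint : Integrable (fun ω => ∫ x, x ∂ν (Y ω)) P := by
    obtain ⟨C, hC⟩ := (Set.finite_range fun i => ‖∫ x, x ∂ν i‖).bddAbove
    exact Integrable.of_bound (hgm.mono hm le_rfl).aestronglyMeasurable C
      (Eventually.of_forall fun ω => hC ⟨Y ω, rfl⟩)
  refine ⟨hint, (ae_eq_condExp_of_forall_setIntegral_eq hm hint (fun _ _ _ => hgint.integrableOn)
    (fun E hE _ => ?_) hgm.aestronglyMeasurable).symm⟩
  have : Fintype ι := Fintype.ofFinite ι
  have hdisj : Pairwise (Function.onFun Disjoint fun i => E ∩ Y ⁻¹' {i}) := fun i j hij =>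
    Set.disjoint_left.2 fun ω h1 h2 => hij (h1.2.symm.trans h2.2)
  rw [hcover E, integral_iUnion_fintype (fun i => hm _ (hE.inter (hY i))) hdisj
      fun i => hgint.integrableOn,
    integral_iUnion_fintype (fun i => hm _ (hE.inter (hY i))) hdisj fun i => hon E hE i]
  refine Finset.sum_congr rfl fun i _ => ?_
  have h1 : ∫ ω in E ∩ Y ⁻¹' {i}, f ω ∂P = P.real (E ∩ Y ⁻¹' {i}) * ∫ x, x ∂ν i := by
    rw [← integral_map (f := fun x : ℝ => x) hf.aemeasurable measurable_id.aestronglyMeasurable,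
      hmap E hE i, integral_smul_measure]
    rfl
  have h2 : ∫ ω in E ∩ Y ⁻¹' {i}, (∫ x, x ∂ν (Y ω)) ∂P = ∫ ω in E ∩ Y ⁻¹' {i}, ∫ x, x ∂ν i ∂P :=
    setIntegral_congr_fun (hm _ (hE.inter (hY i))) fun ω h => by
      simp only [show Y ω = i from h.2]
  rw [h1, h2, setIntegral_const, smul_eq_mul]

end Probability

/-! ### The noise along a run -/

section Run

variable {S A Ω : Type*}

/-- A random function on a finite type, evaluated at a random point, is measurable. -/
theorem measurable_apply_of_finite {ι : Type*} [Finite ι] [MeasurableSpace ι]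
    [DiscreteMeasurableSpace ι] {m : MeasurableSpace Ω} {F : Ω → ι → ℝ} {Y : Ω → ι}
    (hF : ∀ i, Measurable[m] fun ω => F ω i) (hY : Measurable[m] Y) :
    Measurable[m] fun ω => F ω (Y ω) := by
  have h : Measurable fun q : ι × Ω => F q.2 q.1 := measurable_from_prod_countable_right hF
  exact h.comp (hY.prodMk measurable_id)

theorem measurable_logPartition [Fintype A] {ρ : S → A → ℝ} {β : ℝ}
    {m : MeasurableSpace Ω} {G : Ω → S → A → ℝ}
    (hG : ∀ x u, Measurable[m] fun ω => G ω x u) (x : S) :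
    Measurable[m] fun ω => logPartition ρ β (G ω) x := by
  unfold logPartition
  exact Real.measurable_log.comp (Finset.measurable_sum _ fun u _ =>
    (Real.measurable_exp.comp ((hG x u).const_mul (-β))).const_mul _)

variable [Fintype S] [MeasurableSpace S] [DiscreteMeasurableSpace S]
  [MeasurableSpace A] {mΩ : MeasurableSpace Ω} {P : Measure Ω}
  {M : GMDP S A} {ℱ : Filtration ℕ mΩ} {s : ℕ → Ω → S} {a : ℕ → Ω → A} {c : ℕ → Ω → ℝ}

/-- The next state may be substituted into a random function known at time `t`; this is how `G_t`
enters the sampled target. -/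
theorem IsRun.condExp_nextState [IsProbabilityMeasure P] (hrun : IsRun M P ℱ s a c) (t : ℕ)
    {F : Ω → S → ℝ} (hF : ∀ x, Measurable[ℱ t] fun ω => F ω x) {C : ℝ}
    (hFC : ∀ᵐ ω ∂P, ∀ x, |F ω x| ≤ C) :
    Integrable (fun ω => F ω (s (t + 1) ω)) P ∧
      P[fun ω => F ω (s (t + 1) ω) | ℱ t]
        =ᵐ[P] fun ω => ∑ x, M.trans (s t ω) (a t ω) x * F ω x := by
  set I : S → Ω → ℝ := fun x => (s (t + 1) ⁻¹' {x}).indicator fun _ => (1 : ℝ) with hI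
  have hsum : (fun ω => F ω (s (t + 1) ω)) = ∑ x, (fun ω => F ω x) * I x := by
    ext ω
    rw [Finset.sum_apply, Finset.sum_eq_single (s (t + 1) ω)]
    · simp [hI]
    · intro x _ hx
      simp [hI, hx.symm]
    · simp
  have hIint : ∀ x, Integrable (I x) P := fun x => (integrable_const 1).indicator
    (((hrun.state_meas (t + 1)).mono (ℱ.le _) le_rfl) MeasurableSet.of_discrete)
  have hint : ∀ x, Integrable ((fun ω => F ω x) * I x) P := fun x =>
    (hIint x).bdd_mul ((hF x).mono (ℱ.le t) le_rfl).aestronglyMeasurable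
      (hFC.mono fun ω h => h x)
  rw [hsum]
  refine ⟨integrable_finsetSum' _ fun x _ => hint x, ?_⟩
  refine (condExp_finsetSum (fun x _ => hint x) _).trans ?_
  have h1 := ae_all_iff.2 fun x => condExp_mul_of_stronglyMeasurable_left (m := ℱ t)
    (hF x).stronglyMeasurable (hint x) (hIint x)
  filter_upwards [h1, ae_all_iff.2 (hrun.state_law t)] with ω h2 h3
  rw [Finset.sum_apply]
  refine Finset.sum_congr rfl fun x _ => ?_
  rw [h2 x, Pi.mul_apply, mul_comm, h3 x]

variable [DiscreteMeasurableSpace A]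

theorem IsRun.measurableSet_visit (hrun : IsRun M P ℱ s a c) (t : ℕ) (x : S) (u : A) :
    MeasurableSet[ℱ t] {ω | s t ω = x ∧ a t ω = u} :=
  (hrun.state_meas t (MeasurableSet.of_discrete (s := {x}))).inter
    (hrun.action_meas t (MeasurableSet.of_discrete (s := {u})))

theorem IsRun.measurable_rate [DecidableEq S] [DecidableEq A] {α : ℕ → Ω → ℝ}
    (hrun : IsRun M P ℱ s a c) (hα : ∀ t, Measurable[ℱ t] (α t)) (t : ℕ) (x : S) (u : A) :
    Measurable[ℱ t] fun ω => if s t ω = x ∧ a t ω = u then α t ω else 0 :=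
  Measurable.ite (hrun.measurableSet_visit t x u) (hα t) measurable_const

theorem IsRun.condExp_cost [Finite A] [IsProbabilityMeasure P] (hrun : IsRun M P ℱ s a c) (t : ℕ) :
    Integrable (c t) P ∧
      P[c t | ℱ t] =ᵐ[P] fun ω => ∫ r, r ∂M.cost (s t ω) (a t ω) := by
  refine condExp_eq_integral_of_conditional_law (ℱ.le t) (Y := fun ω => (s t ω, a t ω))
    (fun i => ?_) ((hrun.cost_meas t).mono (ℱ.le _) le_rfl) (ν := fun i => M.cost i.1 i.2)
    (fun i => M.cost_prob i.1 i.2) (fun i => M.cost_integrable i.1 i.2) (hrun.cost_law t)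
  exact ((hrun.state_meas t).prodMk (hrun.action_meas t)) MeasurableSet.of_discrete

variable [Fintype A] [DecidableEq S] [DecidableEq A] {γ β : ℝ} {ρ G0 : S → A → ℝ} {α : ℕ → Ω → ℝ}

theorem IsRun.measurable_gLearning (hrun : IsRun M P ℱ s a c) (hα : ∀ t, Measurable[ℱ t] (α t))
    (t : ℕ) (x : S) (u : A) :
    Measurable[ℱ t] fun ω => gLearning γ β ρ G0 (fun i => s i ω) (fun i => a i ω)
      (fun i => c i ω) (fun i => α i ω) t x u := by
  induction t generalizing x u with
  | zero => exact measurable_const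
  | succ t ih =>
    have hle : ℱ t ≤ ℱ (t + 1) := ℱ.mono t.le_succ
    have hα' : Measurable[ℱ (t + 1)] (α t) := (hα t).mono hle le_rfl
    have ih' := fun x u => (ih x u).mono hle le_rfl
    have hv : MeasurableSet[ℱ (t + 1)] {ω | x = s t ω ∧ u = a t ω} := by
      simpa only [eq_comm] using hle _ (hrun.measurableSet_visit t x u)
    simp only [gLearning, sampleTarget]
    refine Measurable.ite hv (((measurable_const.sub hα').mul (ih' x u)).add (hα'.mul
      ((hrun.cost_meas t).sub (Measurable.const_mul ?_ _)))) (ih' x u)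
    exact measurable_apply_of_finite (fun x' => measurable_logPartition ih' x')
      (hrun.state_meas (t + 1))

/-- The noise is a martingale difference: known at time `t + 1`, with conditional mean zero at
time `t`. -/
theorem IsRun.condExp_gNoise [IsProbabilityMeasure P] (hrun : IsRun M P ℱ s a c)
    (hα : ∀ t, Measurable[ℱ t] (α t)) (t : ℕ) (hρ : IsPolicy ρ) (hβ : 0 < β) {m : ℝ}
    (hm : ∀ᵐ ω ∂P, ∀ x u, |gLearning γ β ρ G0 (fun i => s i ω) (fun i => a i ω)
      (fun i => c i ω) (fun i => α i ω) t x u| ≤ m) :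
    Measurable[ℱ (t + 1)] (fun ω => gNoise M γ β ρ G0 (fun i => s i ω) (fun i => a i ω)
      (fun i => c i ω) (fun i => α i ω) t) ∧
    P[fun ω => gNoise M γ β ρ G0 (fun i => s i ω) (fun i => a i ω)
      (fun i => c i ω) (fun i => α i ω) t | ℱ t] =ᵐ[P] 0 := by
  set F : Ω → S → ℝ := fun ω => logPartition ρ β (gLearning γ β ρ G0 (fun i => s i ω)
    (fun i => a i ω) (fun i => c i ω) (fun i => α i ω) t) with hF
  have hFm : ∀ x, Measurable[ℱ t] fun ω => F ω x := fun x =>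
    measurable_logPartition (fun x u => hrun.measurable_gLearning hα t x u) x
  have hFb : ∀ᵐ ω ∂P, ∀ x, |F ω x| ≤ β * m := by
    filter_upwards [hm] with ω h x using abs_logPartition_le hρ hβ (h x)
  obtain ⟨hci, hc⟩ := hrun.condExp_cost t
  obtain ⟨hFi, hFc⟩ := hrun.condExp_nextState t hFm hFb
  set D : Ω → ℝ := fun ω => (∫ r, r ∂M.cost (s t ω) (a t ω))
    - γ / β * ∑ x, M.trans (s t ω) (a t ω) x * F ω x with hD
  have hDm : Measurable[ℱ t] D := by
    have hq := (hrun.state_meas t).prodMk (hrun.action_meas t)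
    refine Measurable.sub ?_ (Measurable.const_mul (Finset.measurable_sum _ fun x _ =>
      Measurable.mul ?_ (hFm x)) _)
    · exact (measurable_of_finite fun q : S × A => ∫ r, r ∂M.cost q.1 q.2).comp hq
    · exact (measurable_of_finite fun q : S × A => M.trans q.1 q.2 x).comp hq
  have hle : ℱ t ≤ ℱ (t + 1) := ℱ.mono t.le_succ
  have hz : (fun ω => gNoise M γ β ρ G0 (fun i => s i ω) (fun i => a i ω)
      (fun i => c i ω) (fun i => α i ω) t)
      = (c t - (γ / β) • fun ω => F ω (s (t + 1) ω)) - D := by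
    ext ω
    simp only [gNoise, bellmanStar, sampleTarget, hD, hF, Pi.sub_apply, Pi.smul_apply, smul_eq_mul]
    ring
  have hTi : Integrable (c t - (γ / β) • fun ω => F ω (s (t + 1) ω)) P := hci.sub (hFi.smul _)
  have hTc : P[c t - (γ / β) • fun ω => F ω (s (t + 1) ω) | ℱ t] =ᵐ[P] D := by
    filter_upwards [condExp_sub hci (hFi.smul (γ / β)) (ℱ t),
      condExp_smul (μ := P) (γ / β) (fun ω => F ω (s (t + 1) ω)) (ℱ t), hc, hFc]
      with ω h1 h2 h3 h4
    rw [h1, Pi.sub_apply, h2, Pi.smul_apply, h3, h4, smul_eq_mul]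
  have hDi : Integrable D P := integrable_condExp.congr hTc
  rw [hz]
  refine ⟨((hrun.cost_meas t).sub ((measurable_apply_of_finite
    (fun x => (hFm x).mono hle le_rfl) (hrun.state_meas (t + 1))).const_smul (γ / β))).sub
    (hDm.mono hle le_rfl), ?_⟩
  filter_upwards [condExp_sub hTi hDi (ℱ t), hTc] with ω h1 h2
  rw [h1, Pi.sub_apply, h2, condExp_of_stronglyMeasurable (ℱ.le t) hDm.stronglyMeasurable hDi]
  simp

end Run

/-! ### Convergence of G-learning -/

theorem mainTheorem2 {S A Ω : Type*}
    [Fintype S] [DecidableEq S] [MeasurableSpace S] [DiscreteMeasurableSpace S]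
    [Fintype A] [DecidableEq A] [MeasurableSpace A] [DiscreteMeasurableSpace A]
    {mΩ : MeasurableSpace Ω} (P : Measure Ω) [IsProbabilityMeasure P]
    (M : GMDP S A) (γ : ℝ) (hγ0 : 0 ≤ γ) (hγ1 : γ < 1) (β : ℝ) (hβ : 0 < β)
    (ρ : S → A → ℝ) (hρ : IsPolicy ρ)
    (ℱ : Filtration ℕ mΩ)
    (s : ℕ → Ω → S) (a : ℕ → Ω → A) (c : ℕ → Ω → ℝ) (hrun : IsRun M P ℱ s a c)
    (G0 : S → A → ℝ)
    -- the learning rates are chosen without knowledge of `c_t` and `s_{t+1}`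
    (α : ℕ → Ω → ℝ) (hα_meas : ∀ t, Measurable[ℱ t] (α t))
    (hα_mem : ∀ t ω, 0 ≤ α t ω ∧ α t ω ≤ 1)
    -- every state-action pair is visited infinitely often
    (hvisit : ∀ᵐ ω ∂P, ∀ x u, ∃ᶠ t in atTop, s t ω = x ∧ a t ω = u)
    -- the learning rates used at the visits to any one pair sum to infinity
    (hα_sum : ∀ᵐ ω ∂P, ∀ x u,
      Tendsto (fun n => ∑ t ∈ Finset.range n, if s t ω = x ∧ a t ω = u then α t ω else 0)
        atTop atTop)
    (hα_sq : ∀ᵐ ω ∂P, Summable fun t => α t ω ^ 2)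
    -- the noise is bounded
    (hnoise : ∃ K : ℝ, ∀ᵐ ω ∂P, ∀ t,
      |gNoise M γ β ρ G0 (fun i => s i ω) (fun i => a i ω) (fun i => c i ω) (fun i => α i ω) t|
        ≤ K) :
    ∃ Gstar : S → A → ℝ,
      (bellmanStar M γ β ρ Gstar = Gstar ∧ ∀ G, bellmanStar M γ β ρ G = G → G = Gstar) ∧
      ∀ᵐ ω ∂P, ∀ x u,
        Tendsto
          (fun t => gLearning γ β ρ G0 (fun i => s i ω) (fun i => a i ω) (fun i => c i ω)
            (fun i => α i ω) t x u)
          atTop (𝓝 (Gstar x u)) := by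
  obtain ⟨Gstar, hG, huniq⟩ := existsUnique_bellmanStar_fixedPoint M hγ0 hγ1 hρ hβ
  refine ⟨Gstar, ⟨hG, huniq⟩, ?_⟩
  obtain ⟨K, hK⟩ := hnoise
  obtain ⟨m, hm⟩ := exists_bound_gLearning M hγ0 hγ1 hρ hβ G0 K
  have hmean := fun t => hrun.condExp_gNoise hα_meas t hρ hβ
    (hK.mono fun ω h => hm _ _ _ _ (fun t => hα_mem t ω) h t)
  have hseries : ∀ x u, ∀ᵐ ω ∂P, ∃ l, Tendsto (fun n => ∑ t ∈ Finset.range n,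
      (if s t ω = x ∧ a t ω = u then α t ω else 0) * gNoise M γ β ρ G0 (fun i => s i ω)
        (fun i => a i ω) (fun i => c i ω) (fun i => α i ω) t) atTop (𝓝 l) := fun x u =>
    ae_tendsto_sum_mul_of_summable_sq (fun t => (hmean t).1) (abs_nonneg K)
      (hK.mono fun ω h t => (h t).trans (le_abs_self K)) (fun t => (hmean t).2)
      (fun t => hrun.measurable_rate hα_meas t x u)
      (hα_sq.mono fun ω h => h.of_nonneg_of_le (fun t => sq_nonneg _) fun t => by
        split_ifs
        · exact le_rfl
        · simpa using sq_nonneg (α t ω))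
  filter_upwards [ae_all_iff.2 fun x => ae_all_iff.2 (hseries x), hα_sum, hK] with ω h1 h2 h3 x u
  exact tendsto_gLearning_of_noise_summable M hγ0 hγ1 hρ hβ hG (fun t => hα_mem t ω) h2 h3 h1 x u
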